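/- Let $A$ and $B$ be $3\times 3$ complex Hermitian positive definite matrices, and let $p(t)=\operatorname{Tr}[(A+tB)^6]$, a polynomial in $t$ of degree $6$. For integers $0\le k\le 6$, let $S_{6,k}(A,B)$ be the sum of all words (products) of length $6$ in the letters $A$ and $B$ in which exactly $k$ letters are $B$. Then, for every $k\in\{0,1,\dots,6\}$, the coefficient of $t^k$ in $p(t)$ equals $\operatorname{Tr}[S_{6,k}(A,B)]$ and is a (strictly) positive real number. In particular, $\operatorname{Tr}[S_{6,3}(A,B)]>0$. -/

import Mathlib

open scoped ComplexOrder

/-- The polynomial `p(t) = Tr[(A + tB)^m]` in `ℂ[t]`, as the trace of the `m`-th power of the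
matrix `A + tB` with entries in `ℂ[t]`. -/
noncomputable def tracePolynomial {n : ℕ} (m : ℕ) (A B : Matrix (Fin n) (Fin n) ℂ) :
    Polynomial ℂ :=
  Matrix.trace ((A.map Polynomial.C + (Polynomial.X : Polynomial ℂ) • B.map Polynomial.C) ^ m)

/-- The word of length `m` in `A` and `B` whose `i`-th letter is `B` if `i ∈ s` and `A` otherwise,
evaluated as a matrix product from left to right. -/
def wordProduct {n m : ℕ} (A B : Matrix (Fin n) (Fin n) ℂ) (s : Finset (Fin m)) :
    Matrix (Fin n) (Fin n) ℂ :=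
  (List.ofFn fun i : Fin m => if i ∈ s then B else A).prod

/-- The `k`-th Hurwitz product `S_{m,k}(A,B)`: the sum of all words of length `m` in `A` and `B`
in which exactly `k` letters are `B`. -/
def hurwitzProduct {n : ℕ} (m k : ℕ) (A B : Matrix (Fin n) (Fin n) ℂ) :
    Matrix (Fin n) (Fin n) ℂ :=
  ∑ s ∈ Finset.powersetCard k (Finset.univ : Finset (Fin m)), wordProduct A B s

/-!
The coefficient of `t^k` in `Tr[(A + tB)^6]` is `Tr S_{6,k}(A, B)` by noncommutative expansion
(`coeff_tracePolynomial`). For `k ≠ 3` its cyclic classes of words are traces of products of two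
positive definite matrices, hence positive (`trace_mul_pos`).

The case `k = 3` cannot be settled class by class, because `Tr(A² B A B²)` can have negative real
part. It is deduced from words of length seven, where `Tr S_{7,3}(A, B)` is, up to a factor, a sum
of traces of matrices `Vᴴ B V` (`necklaceSumSeven_eq`), so nonnegative on positive semidefinite and
positive on positive definite pairs.

The passage from seven to six is variational. Under the congruence `A ↦ X A X`, `B ↦ X B X` with
`X = 1 + t A`, the derivative of `Tr S_{6,3}` at `t = 0` is a positive multiple of `Tr S_{7,3}`
(`hasDerivAt_necklaceSumSix`). If `Tr S_{6,3}` were negative somewhere, then by compactness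
`Tr S_{6,3}(A, B) ≥ c (Tr A)³ (Tr B)³` with equality at some pair and `c < 0` (`exists_isMin`).
The difference of both sides is stationary at that pair; but its derivative along the congruence
is the nonnegative term from `Tr S_{7,3}` plus `-c` times the derivative of `(Tr A)³ (Tr B)³`, which
is positive. So `Tr S_{6,3} ≥ 0`, and a zero at a positive definite pair would be a minimum,
forcing `Tr S_{7,3} = 0` there, which is excluded.
-/

open Matrix

/-! ### The coefficients of the trace polynomial -/

/-- The noncommutative binomial expansion of `(A + tB)^m`, indexed by the set `s` of positions
holding `B`. It is multilinearity of the product map, over the coefficient ring `ℂ[t]`. -/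
theorem tracePolynomial_eq_sum {n : ℕ} (m : ℕ) (A B : Matrix (Fin n) (Fin n) ℂ) :
    tracePolynomial m A B = ∑ s : Finset (Fin m),
      Polynomial.X ^ s.card * Polynomial.C (wordProduct A B s).trace := by
  set A' : Matrix (Fin n) (Fin n) (Polynomial ℂ) := A.map Polynomial.C with hA'
  set B' : Matrix (Fin n) (Fin n) (Polynomial ℂ) := B.map Polynomial.C with hB'
  have hexp : (A' + (Polynomial.X : Polynomial ℂ) • B') ^ m = ∑ s : Finset (Fin m),
      (Polynomial.X : Polynomial ℂ) ^ s.card • (wordProduct A B s).map Polynomial.C := by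
    have h := (MultilinearMap.mkPiAlgebraFin (Polynomial ℂ) m
      (Matrix (Fin n) (Fin n) (Polynomial ℂ))).map_add_univ
        (fun _ => (Polynomial.X : Polynomial ℂ) • B') (fun _ => A')
    rw [MultilinearMap.mkPiAlgebraFin_apply] at h
    simp only [Pi.add_def, List.ofFn_const, List.prod_replicate] at h
    rw [add_comm, h]
    refine Finset.sum_congr rfl fun s _ => ?_
    have h2 := (MultilinearMap.mkPiAlgebraFin (Polynomial ℂ) m
      (Matrix (Fin n) (Fin n) (Polynomial ℂ))).map_piecewise_smul
        (fun _ => (Polynomial.X : Polynomial ℂ)) (s.piecewise (fun _ => B') (fun _ => A')) s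
    have h3 : s.piecewise (fun i => (Polynomial.X : Polynomial ℂ) •
          s.piecewise (fun _ => B') (fun _ => A') i) (s.piecewise (fun _ => B') (fun _ => A'))
        = s.piecewise (fun _ => (Polynomial.X : Polynomial ℂ) • B') (fun _ => A') := by
      ext1 i
      by_cases hi : i ∈ s <;> simp [hi]
    rw [h3] at h2
    rw [h2, Finset.prod_const, MultilinearMap.mkPiAlgebraFin_apply]
    congr 1
    change _ = (Polynomial.C.mapMatrix) (wordProduct A B s)
    rw [wordProduct, map_list_prod, List.map_ofFn]
    congr 2
    ext1 i
    by_cases hi : i ∈ s <;> simp [hi, hA', hB']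
  rw [tracePolynomial, hexp, Matrix.trace_sum]
  refine Finset.sum_congr rfl fun s _ => ?_
  rw [Matrix.trace_smul, smul_eq_mul]
  congr 1
  simp [Matrix.trace]

theorem coeff_tracePolynomial {n : ℕ} (m k : ℕ) (A B : Matrix (Fin n) (Fin n) ℂ) :
    (tracePolynomial m A B).coeff k = (hurwitzProduct m k A B).trace := by
  rw [tracePolynomial_eq_sum, hurwitzProduct, Matrix.trace_sum, Polynomial.finsetSum_coeff,
    ← Finset.univ_filter_card_eq, Finset.sum_filter]
  refine Finset.sum_congr rfl fun s _ => ?_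
  rw [Polynomial.coeff_X_pow_mul', Polynomial.coeff_C]
  grind

/-- The trace polynomial seen through `ℂ[t]`-valued matrices as polynomials with matrix
coefficients. In this form the recursion `coeff_C_add_X_mul_C_pow_succ_succ` expands a coefficient
into words. -/
theorem coeff_tracePolynomial_eq_trace_coeff {n : ℕ} (m k : ℕ)
    (A B : Matrix (Fin n) (Fin n) ℂ) :
    (tracePolynomial m A B).coeff k =
      (((Polynomial.C A + Polynomial.X * Polynomial.C B) ^ m).coeff k).trace := by
  have h : matPolyEquiv (A.map Polynomial.C + (Polynomial.X : Polynomial ℂ) • B.map Polynomial.C)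
      = Polynomial.C A + Polynomial.X * Polynomial.C B := by
    simp [matPolyEquiv_map_smul]
  rw [← h, ← map_pow, tracePolynomial]
  simp only [Matrix.trace, Matrix.diag_apply, Polynomial.finsetSum_coeff, matPolyEquiv_coeff_apply]

section Expand

variable {R : Type*} [Ring R] (a b : R)

theorem coeff_C_add_X_mul_C_pow_succ_zero (m : ℕ) :
    ((Polynomial.C a + Polynomial.X * Polynomial.C b) ^ (m + 1)).coeff 0 =
      a * ((Polynomial.C a + Polynomial.X * Polynomial.C b) ^ m).coeff 0 := by
  rw [pow_succ', add_mul, mul_assoc]; simp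

theorem coeff_C_add_X_mul_C_pow_succ_succ (m k : ℕ) :
    ((Polynomial.C a + Polynomial.X * Polynomial.C b) ^ (m + 1)).coeff (k + 1) =
      a * ((Polynomial.C a + Polynomial.X * Polynomial.C b) ^ m).coeff (k + 1) +
      b * ((Polynomial.C a + Polynomial.X * Polynomial.C b) ^ m).coeff k := by
  rw [pow_succ', add_mul, mul_assoc]; simp

end Expand

/-! ### Words of length six and seven up to rotation -/

theorem trace_rotate_six {n : Type*} [Fintype n] (a b c d e f : Matrix n n ℂ) :
    (a * (b * (c * (d * (e * f))))).trace = (b * (c * (d * (e * (f * a))))).trace := by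
  rw [Matrix.trace_mul_comm]; simp only [mul_assoc]

theorem trace_rotate_seven {n : Type*} [Fintype n] (a b c d e f g : Matrix n n ℂ) :
    (a * (b * (c * (d * (e * (f * g)))))).trace = (b * (c * (d * (e * (f * (g * a)))))).trace := by
  rw [Matrix.trace_mul_comm]; simp only [mul_assoc]

variable {n : Type*} [Fintype n]

/-- Half of `Tr S_{6,3}(A, B)`, with one word per cyclic class, in the right-associated form in
which words are compared throughout. -/
noncomputable def necklaceSumSix (A B : Matrix n n ℂ) : ℂ :=
  3 * (A * (A * (A * (B * (B * B))))).trace + 3 * (A * (A * (B * (A * (B * B))))).trace +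
    3 * (A * (A * (B * (B * (A * B))))).trace + (A * (B * (A * (B * (A * B))))).trace

/-- One seventh of `Tr S_{7,3}(A, B)`: each of the five cyclic classes of words in four `A` and
three `B` has seven members. -/
noncomputable def necklaceSumSeven (A B : Matrix n n ℂ) : ℂ :=
  (A * (A * (A * (A * (B * (B * B)))))).trace + (A * (A * (A * (B * (A * (B * B)))))).trace +
    (A * (A * (A * (B * (B * (A * B)))))).trace + (A * (A * (B * (A * (A * (B * B)))))).trace +
    (A * (A * (B * (A * (B * (A * B)))))).trace

/-- The sum-of-squares certificate for `Tr S_{7,3}`. A word `Vᴴ B V` has four `A` and three `B`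
exactly if `V` has two `A` and one `B`, so `Tr S_{7,3}` is represented by Gram matrices indexed by
`A A B`, `A B A`, `B A A`; the one used here is `vᵀ v + diag(2, 2, 0)` with `v = (-1, 1, 1)`. -/
theorem necklaceSumSeven_eq {A B : Matrix n n ℂ} (hA : A.IsHermitian) (hB : B.IsHermitian) :
    necklaceSumSeven A B =
      ((-(A * A * B) + A * B * A + B * A * A)ᴴ * B * (-(A * A * B) + A * B * A + B * A * A)).trace +
      2 * ((A * A * B)ᴴ * B * (A * A * B)).trace + 2 * ((A * B * A)ᴴ * B * (A * B * A)).trace := by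
  simp only [necklaceSumSeven, conjTranspose_add, conjTranspose_neg, conjTranspose_mul, hA.eq,
    hB.eq, mul_add, add_mul, mul_assoc, neg_mul, mul_neg, trace_add, trace_neg]
  grind [trace_rotate_seven]

theorem necklaceSumSeven_nonneg {A B : Matrix n n ℂ} (hA : A.IsHermitian) (hB : B.PosSemidef) :
    0 ≤ necklaceSumSeven A B := by
  rw [necklaceSumSeven_eq hA hB.isHermitian]
  have h (V : Matrix n n ℂ) : 0 ≤ (Vᴴ * B * V).trace :=
    (hB.conjTranspose_mul_mul_same V).trace_nonneg
  exact add_nonneg (add_nonneg (h _) (mul_nonneg zero_le_two (h _))) (mul_nonneg zero_le_two (h _))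

theorem posDef_conjTranspose_mul_mul [DecidableEq n] {B V : Matrix n n ℂ} (hB : B.PosDef)
    (hV : IsUnit V) : (Vᴴ * B * V).PosDef :=
  (hV.posDef_star_left_conjugate_iff).2 hB

theorem necklaceSumSeven_pos [DecidableEq n] [Nonempty n] {A B : Matrix n n ℂ}
    (hA : A.PosDef) (hB : B.PosDef) : 0 < necklaceSumSeven A B := by
  rw [necklaceSumSeven_eq hA.isHermitian hB.isHermitian]
  have h (V : Matrix n n ℂ) : 0 ≤ (Vᴴ * B * V).trace :=
    (hB.posSemidef.conjTranspose_mul_mul_same V).trace_nonneg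
  exact add_pos_of_nonneg_of_pos (add_nonneg (h _) (mul_nonneg zero_le_two (h _)))
    (mul_pos zero_lt_two
      (posDef_conjTranspose_mul_mul hB ((hA.isUnit.mul hB.isUnit).mul hA.isUnit)).trace_pos)

theorem necklaceSumSix_smul (r s : ℂ) (A B : Matrix n n ℂ) :
    necklaceSumSix (r • A) (s • B) = r ^ 3 * s ^ 3 * necklaceSumSix A B := by
  simp only [necklaceSumSix, smul_mul_assoc, mul_smul_comm, trace_smul, smul_eq_mul]
  ring

theorem star_necklaceSumSix {A B : Matrix n n ℂ} (hA : A.IsHermitian) (hB : B.IsHermitian) :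
    star (necklaceSumSix A B) = necklaceSumSix A B := by
  simp only [necklaceSumSix, star_add, star_mul', ← trace_conjTranspose, conjTranspose_mul,
    hA.eq, hB.eq, mul_assoc, star_ofNat]
  grind [trace_rotate_six]

/-! ### Traces of products of positive matrices -/

theorem exists_eq_conjTranspose_mul_self [DecidableEq n] {A : Matrix n n ℂ}
    (hA : A.PosSemidef) : ∃ C, A = Cᴴ * C := by
  open scoped MatrixOrder in
  exact CStarAlgebra.nonneg_iff_eq_star_mul_self.mp hA.nonneg

theorem trace_mul_nonneg [DecidableEq n] {A B : Matrix n n ℂ} (hA : A.PosSemidef)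
    (hB : B.PosSemidef) : 0 ≤ (A * B).trace := by
  obtain ⟨C, rfl⟩ := exists_eq_conjTranspose_mul_self hA
  rw [mul_assoc, trace_mul_comm]
  exact (hB.mul_mul_conjTranspose_same C).trace_nonneg

theorem trace_mul_pos [DecidableEq n] [Nonempty n] {A B : Matrix n n ℂ} (hA : A.PosDef)
    (hB : B.PosDef) : 0 < (A * B).trace := by
  obtain ⟨C, rfl⟩ := exists_eq_conjTranspose_mul_self hA.posSemidef
  have hC : IsUnit C := by
    have := (isUnit_iff_isUnit_det _).1 hA.isUnit
    rw [det_mul] at this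
    exact (isUnit_iff_isUnit_det _).2 (isUnit_of_mul_isUnit_right this)
  rw [mul_assoc, trace_mul_comm]
  exact ((hC.posDef_star_right_conjugate_iff).2 hB).trace_pos

/-! ### The derivative along a congruence -/

section Analysis

attribute [local instance] Matrix.frobeniusNormedRing Matrix.frobeniusNormedAlgebra

variable [DecidableEq n]

theorem frobenius_norm_sq (C : Matrix n n ℂ) : ‖C‖ ^ 2 = (Cᴴ * C).trace.re := by
  rw [frobenius_norm_def, ← Real.sqrt_eq_rpow, Real.sq_sqrt (by positivity)]
  simp only [trace, diag_apply, mul_apply, conjTranspose_apply, Complex.re_sum]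
  rw [Finset.sum_comm]
  refine Finset.sum_congr rfl fun i _ => Finset.sum_congr rfl fun j _ => ?_
  simp [← Complex.normSq_eq_norm_sq, Complex.normSq_apply]

/-- The descent from length seven to length six: replacing one letter `A` by `2 A²`, or one `B` by
`A B + B A`, is inserting an `A` on either side of that letter. The words of `S_{6,3}` thereby
produce all words of `S_{7,3}`, each cyclic class equally often. -/
theorem hasDerivAt_necklaceSumSix {a b : ℝ → Matrix n n ℂ}
    (ha : HasDerivAt a (2 * (a 0 * a 0)) 0) (hb : HasDerivAt b (a 0 * b 0 + b 0 * a 0) 0) :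
    HasDerivAt (fun t => necklaceSumSix (a t) (b t)) (24 * necklaceSumSeven (a 0) (b 0)) 0 := by
  have tr {f : ℝ → Matrix n n ℂ} {f' : Matrix n n ℂ} (h : HasDerivAt f f' 0) :
      HasDerivAt (fun t => (f t).trace) f'.trace 0 :=
    ((Matrix.traceLinearMap n ℝ ℂ).toContinuousLinearMap.hasFDerivAt.comp_hasDerivAt 0 h)
  have h1 := tr (ha.mul (ha.mul (ha.mul (hb.mul (hb.mul hb)))))
  have h2 := tr (ha.mul (ha.mul (hb.mul (ha.mul (hb.mul hb)))))
  have h3 := tr (ha.mul (ha.mul (hb.mul (hb.mul (ha.mul hb)))))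
  have h4 := tr (ha.mul (hb.mul (ha.mul (hb.mul (ha.mul hb)))))
  have h := (((h1.const_mul 3).add (h2.const_mul 3)).add (h3.const_mul 3)).add h4
  refine h.congr_deriv ?_
  clear h h1 h2 h3 h4 tr ha hb
  generalize hA : a 0 = A
  generalize hB : b 0 = B
  simp only [Pi.mul_apply, hA, hB, two_mul, mul_add, add_mul, mul_assoc, Matrix.trace_add,
    necklaceSumSeven]
  grind [trace_rotate_seven]

theorem hasDerivAt_congruence (A B : Matrix n n ℂ) :
    HasDerivAt (fun t : ℝ => (1 + t • A) * B * (1 + t • A)) (A * B + B * A) 0 := by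
  have h : HasDerivAt (fun t : ℝ => 1 + t • A) A 0 :=
    (((hasDerivAt_id (0 : ℝ)).smul_const A).const_add 1).congr_deriv (one_smul ℝ A)
  exact ((h.mul_const B).mul h).congr_deriv (by simp)

theorem hasDerivAt_trace_re {f : ℝ → Matrix n n ℂ} {f' : Matrix n n ℂ} {t : ℝ}
    (h : HasDerivAt f f' t) : HasDerivAt (fun t => (f t).trace.re) f'.trace.re t :=
  Complex.reCLM.hasFDerivAt.comp_hasDerivAt t
    ((Matrix.traceLinearMap n ℝ ℂ).toContinuousLinearMap.hasFDerivAt.comp_hasDerivAt t h)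

/-- The Euler–Lagrange equation of minimising `Tr S_{6,3}` relative to the cubes of the traces,
along the congruences by `1 + t A`. -/
theorem necklaceSumSeven_of_isMin (A B : Matrix n n ℂ) (c : ℝ)
    (hmin : ∀ t : ℝ, c * (((1 + t • A) * A * (1 + t • A)).trace.re ^ 3 *
        ((1 + t • A) * B * (1 + t • A)).trace.re ^ 3) ≤
      (necklaceSumSix ((1 + t • A) * A * (1 + t • A)) ((1 + t • A) * B * (1 + t • A))).re)
    (heq : (necklaceSumSix A B).re = c * (A.trace.re ^ 3 * B.trace.re ^ 3)) :
    24 * (necklaceSumSeven A B).re = 6 * c * (A.trace.re ^ 2 * B.trace.re ^ 2) *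
      ((A * A).trace.re * B.trace.re + A.trace.re * (A * B).trace.re) := by
  have ha := hasDerivAt_congruence A A
  have hb := hasDerivAt_congruence A B
  have h1 := hasDerivAt_necklaceSumSix (ha.congr_deriv (by simp [two_mul]))
    (hb.congr_deriv (by simp))
  have h2 := Complex.reCLM.hasFDerivAt.comp_hasDerivAt (0 : ℝ) h1
  have h3 := (((hasDerivAt_trace_re ha).pow 3).mul ((hasDerivAt_trace_re hb).pow 3)).const_mul c
  have h4 := IsLocalMin.hasDerivAt_eq_zero (Filter.Eventually.of_forall fun t => ?_) (h2.sub h3)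
  · have h5 : (B * A).trace = (A * B).trace := trace_mul_comm _ _
    simp [h5] at h4
    linear_combination h4
  · have := hmin t
    simp [heq]
    linarith

/-! ### Positivity of the middle coefficient -/

/-- If `Tr S_{6,3}` takes a negative value at positive semidefinite matrices, then the homogeneous
bound `Tr S_{6,3} / 2 ≥ c (Tr A)³ (Tr B)³` holds with a negative constant `c`, attained at
matrices of trace one. Writing positive semidefinite matrices as `Cᴴ C` turns the trace-one
condition into the compact Frobenius unit sphere. -/
theorem exists_isMin {C₀ D₀ : Matrix n n ℂ}
    (h₀ : (necklaceSumSix (C₀ᴴ * C₀) (D₀ᴴ * D₀)).re < 0) :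
    ∃ (c : ℝ) (C D : Matrix n n ℂ), c < 0 ∧ (Cᴴ * C).trace.re = 1 ∧ (Dᴴ * D).trace.re = 1 ∧
      (necklaceSumSix (Cᴴ * C) (Dᴴ * D)).re = c ∧
      ∀ C' D' : Matrix n n ℂ, c * ((C'ᴴ * C').trace.re ^ 3 * (D'ᴴ * D').trace.re ^ 3) ≤
        (necklaceSumSix (C'ᴴ * C') (D'ᴴ * D')).re := by
  have : ProperSpace (Matrix n n ℂ) := FiniteDimensional.proper ℝ _
  have hcont : Continuous fun p : Matrix n n ℂ × Matrix n n ℂ =>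
      (necklaceSumSix (p.1ᴴ * p.1) (p.2ᴴ * p.2)).re := by
    unfold necklaceSumSix
    fun_prop
  have hscale (C D : Matrix n n ℂ) (hC : C ≠ 0) (hD : D ≠ 0) :
      (necklaceSumSix (Cᴴ * C) (Dᴴ * D)).re = (‖C‖ ^ 2) ^ 3 * (‖D‖ ^ 2) ^ 3 *
        (necklaceSumSix ((‖C‖⁻¹ • C)ᴴ * (‖C‖⁻¹ • C)) ((‖D‖⁻¹ • D)ᴴ * (‖D‖⁻¹ • D))).re := by
    have h (C : Matrix n n ℂ) (hC : C ≠ 0) :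
        Cᴴ * C = ((‖C‖ ^ 2 : ℝ) : ℂ) • ((‖C‖⁻¹ • C)ᴴ * (‖C‖⁻¹ • C)) := by
      have : ‖C‖ ≠ 0 := norm_ne_zero_iff.2 hC
      rw [Complex.coe_smul, conjTranspose_smul, smul_mul_smul, smul_smul, star_trivial]
      rw [show ‖C‖ ^ 2 * (‖C‖⁻¹ * ‖C‖⁻¹) = 1 by field_simp, one_smul]
    conv_lhs => rw [h C hC, h D hD, necklaceSumSix_smul]
    rw [← Complex.ofReal_pow, ← Complex.ofReal_pow, ← Complex.ofReal_mul, Complex.re_ofReal_mul]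
  have hunit (C : Matrix n n ℂ) (hC : C ≠ 0) : ‖C‖⁻¹ • C ∈ Metric.sphere (0 : Matrix n n ℂ) 1 := by
    simp [norm_smul, hC]
  have hC₀ : C₀ ≠ 0 := by rintro rfl; simp [necklaceSumSix] at h₀
  have hD₀ : D₀ ≠ 0 := by rintro rfl; simp [necklaceSumSix] at h₀
  obtain ⟨⟨C, D⟩, ⟨hC, hD⟩, hCD⟩ := ((isCompact_sphere (0 : Matrix n n ℂ) 1).prod
    (isCompact_sphere (0 : Matrix n n ℂ) 1)).exists_isMinOn
    ⟨(_, _), hunit C₀ hC₀, hunit D₀ hD₀⟩ hcont.continuousOn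
  have hle (C' D' : Matrix n n ℂ) (hC' : C' ≠ 0) (hD' : D' ≠ 0) :=
    hCD (Set.mk_mem_prod (hunit C' hC') (hunit D' hD'))
  simp only [Set.mem_ofPred_eq] at hle
  refine ⟨_, C, D, ?_, ?_, ?_, rfl, fun C' D' => ?_⟩
  · refine (hle C₀ D₀ hC₀ hD₀).trans_lt ?_
    rw [hscale C₀ D₀ hC₀ hD₀] at h₀
    have := norm_pos_iff.2 hC₀
    have := norm_pos_iff.2 hD₀
    exact neg_of_mul_neg_right h₀ (by positivity)
  · rw [← frobenius_norm_sq, mem_sphere_zero_iff_norm.1 hC, one_pow]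
  · rw [← frobenius_norm_sq, mem_sphere_zero_iff_norm.1 hD, one_pow]
  · by_cases hC' : C' = 0
    · simp [hC', necklaceSumSix]
    by_cases hD' : D' = 0
    · simp [hD', necklaceSumSix]
    rw [hscale C' D' hC' hD', ← frobenius_norm_sq, ← frobenius_norm_sq, mul_comm]
    exact mul_le_mul_of_nonneg_left (hle C' D' hC' hD') (by positivity)

end Analysis

variable [DecidableEq n]

theorem congruence_conjTranspose_mul_self {A : Matrix n n ℂ} (hA : A.IsHermitian) (C : Matrix n n ℂ)
    (t : ℝ) : (1 + t • A) * (Cᴴ * C) * (1 + t • A) =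
      (C * (1 + t • A))ᴴ * (C * (1 + t • A)) := by
  simp [conjTranspose_mul, hA.eq, mul_assoc]

/-- At a negative minimum the Euler–Lagrange equation would equate `Tr S_{7,3} ≥ 0`, up to a
positive factor, with a negative number. -/
theorem necklaceSumSix_re_nonneg {A B : Matrix n n ℂ} (hA : A.PosSemidef) (hB : B.PosSemidef) :
    0 ≤ (necklaceSumSix A B).re := by
  obtain ⟨C₀, rfl⟩ := exists_eq_conjTranspose_mul_self hA
  obtain ⟨D₀, rfl⟩ := exists_eq_conjTranspose_mul_self hB
  by_contra! h₀
  obtain ⟨c, C, D, hc, hC, hD, hCD, hmin⟩ := exists_isMin h₀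
  have hA := posSemidef_conjTranspose_mul_self C
  have hB := posSemidef_conjTranspose_mul_self D
  have h := necklaceSumSeven_of_isMin (Cᴴ * C) (Dᴴ * D) c (fun t => by
    simpa only [congruence_conjTranspose_mul_self hA.isHermitian] using
      hmin (C * (1 + t • (Cᴴ * C))) (D * (1 + t • (Cᴴ * C)))) (by simp [hC, hD, hCD])
  rw [hC, hD] at h
  have h7 := (Complex.le_def.1 (necklaceSumSeven_nonneg hA.isHermitian hB)).1
  have hAB := (Complex.le_def.1 (trace_mul_nonneg hA hB)).1
  have hAA : 0 < ((Cᴴ * C) * (Cᴴ * C)).trace.re := by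
    have h1 := trace_mul_nonneg hA hA
    have h2 : ((Cᴴ * C) * (Cᴴ * C)).trace ≠ 0 := fun h2 => by
      nth_rw 1 [← hA.isHermitian.eq] at h2
      rw [trace_conjTranspose_mul_self_eq_zero_iff] at h2
      simp [h2] at hC
    exact (Complex.lt_def.1 (h1.lt_of_ne' h2)).1
  simp only [Complex.zero_re] at h7 hAB
  -- `h` equates the nonnegative `h7` term with `6 c (Tr A² + Tr A B)`, where `c < 0`.
  nlinarith

/-- A zero at positive definite matrices would be a minimum, so `Tr S_{7,3}` would vanish there. -/
theorem necklaceSumSix_pos [Nonempty n] {A B : Matrix n n ℂ} (hA : A.PosDef) (hB : B.PosDef) :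
    0 < necklaceSumSix A B := by
  have hre := necklaceSumSix_re_nonneg hA.posSemidef hB.posSemidef
  have him : (necklaceSumSix A B).im = 0 := by
    have h := congrArg Complex.im (star_necklaceSumSix hA.isHermitian hB.isHermitian)
    rw [Complex.star_def, Complex.conj_im] at h
    linarith
  refine Complex.lt_def.2 ⟨hre.lt_of_ne' fun h0 => ?_, him.symm⟩
  have hpsd {M : Matrix n n ℂ} (hM : M.PosSemidef) (t : ℝ) :
      ((1 + t • A) * M * (1 + t • A)).PosSemidef := by
    have hX : (1 + t • A)ᴴ = 1 + t • A := by simp [hA.isHermitian.eq]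
    have h := hM.conjTranspose_mul_mul_same (1 + t • A)
    rwa [hX] at h
  have h := necklaceSumSeven_of_isMin A B 0 (fun t => by
    simpa using necklaceSumSix_re_nonneg (hpsd hA.posSemidef t) (hpsd hB.posSemidef t))
    (by simpa using h0)
  have h7 := (Complex.lt_def.1 (necklaceSumSeven_pos hA hB)).1
  simp only [mul_zero, zero_mul, Complex.zero_re] at h h7
  linarith

theorem posDef_mul_mul {A B : Matrix n n ℂ} (hA : A.PosDef) (hB : B.PosDef) :
    (A * B * A).PosDef := by
  simpa [hA.isHermitian.eq] using posDef_conjTranspose_mul_mul hB hA.isUnit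

/-! ### Positivity of all coefficients -/

/-- For `3 × 3` complex Hermitian positive definite `A` and `B`, the coefficient of `t^k` in
`Tr[(A + tB)^6]`, which is `Tr[S_{6,k}(A,B)]`, is a positive real number for `k = 0, …, 6`.
(In the order of `ℂ` used here, `0 < z` means that `z` is real and positive.) -/
theorem mainTheorem1 (A B : Matrix (Fin 3) (Fin 3) ℂ) (hA : A.PosDef) (hB : B.PosDef) :
    ∀ k : ℕ, k ≤ 6 →
      (tracePolynomial 6 A B).coeff k = (hurwitzProduct 6 k A B).trace ∧
      0 < (tracePolynomial 6 A B).coeff k := by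
  refine fun k hk => ⟨coeff_tracePolynomial 6 k A B, ?_⟩
  have hAA : (A * A).PosDef := by simpa using posDef_mul_mul hA .one
  have hBB : (B * B).PosDef := by simpa using posDef_mul_mul hB .one
  have hAAA := posDef_mul_mul hA hA
  have hBBB := posDef_mul_mul hB hB
  have hABA := posDef_mul_mul hA hB
  have hBAB := posDef_mul_mul hB hA
  have h6 : (0 : ℂ) < 6 := by norm_num
  have h3 : (0 : ℂ) < 3 := by norm_num
  have h2 : (0 : ℂ) < 2 := by norm_num
  -- One representative of each cyclic class; for `k ≠ 3` it is bracketed as a product of two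
  -- positive definite matrices.
  suffices h : (tracePolynomial 6 A B).coeff k =
      match k with
      | 0 => (A * A * A * (A * A * A)).trace
      | 1 => 6 * (A * (A * A * A) * A * B).trace
      | 2 => 6 * (A * (A * A) * A * (B * B)).trace + 6 * (A * A * A * (B * A * B)).trace +
          3 * (A * B * A * (A * B * A)).trace
      | 3 => 2 * necklaceSumSix A B
      | 4 => 6 * (B * (B * B) * B * (A * A)).trace + 6 * (B * B * B * (A * B * A)).trace +
          3 * (B * A * B * (B * A * B)).trace
      | 5 => 6 * (B * (B * B * B) * B * A).trace
      | _ => (B * B * B * (B * B * B)).trace by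
    rw [h]
    interval_cases k
    · exact trace_mul_pos hAAA hAAA
    · exact mul_pos h6 (trace_mul_pos (posDef_mul_mul hA hAAA) hB)
    · exact add_pos (add_pos (mul_pos h6 (trace_mul_pos (posDef_mul_mul hA hAA) hBB))
        (mul_pos h6 (trace_mul_pos hAAA hBAB))) (mul_pos h3 (trace_mul_pos hABA hABA))
    · exact mul_pos h2 (necklaceSumSix_pos hA hB)
    · exact add_pos (add_pos (mul_pos h6 (trace_mul_pos (posDef_mul_mul hB hBB) hAA))
        (mul_pos h6 (trace_mul_pos hBBB hABA))) (mul_pos h3 (trace_mul_pos hBAB hBAB))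
    · exact mul_pos h6 (trace_mul_pos (posDef_mul_mul hB hBBB) hA)
    · exact trace_mul_pos hBBB hBBB
  rw [coeff_tracePolynomial_eq_trace_coeff]
  interval_cases k <;>
    simp only [coeff_C_add_X_mul_C_pow_succ_zero, coeff_C_add_X_mul_C_pow_succ_succ, pow_zero,
      Polynomial.coeff_one, mul_one, mul_add, trace_add, mul_zero, reduceIte, add_zero,
      zero_add, Nat.reduceEqDiff,
      OfNat.ofNat_ne_zero, one_ne_zero, necklaceSumSix, mul_assoc] <;>
    grind [trace_rotate_six]
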